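/- An *ai-semiring* is a set with two associative binary operations $+$ and $\cdot$ such that $+$ is commutative and idempotent and $\cdot$ distributes over $+$ on both sides (no neutral elements are required). A *variety* is a class of ai-semirings closed under homomorphic images, subsemirings and direct products, and $\mathbf V(S)$ denotes the smallest variety containing the ai-semiring $S$. A *3-hypergraph* $\mathbb H=(V,E)$ here is a finite vertex set $V$ together with a nonempty set $E$ of 3-element subsets of $V$ (the hyperedges) such that any two distinct hyperedges share at most one vertex and every vertex lies in some hyperedge. A *subhyperedge* is a subset of a hyperedge; two subhyperedges are *linked* if there is a single vertex, in neither of them, that completes each of them to a hyperedge. The *3-hypergraph semiring* $S_{\mathbb H}$ has as multiplicative reduct the semigroup generated by the symbols $0$ and $\mathbf a_u$ $(u\in V)$ subject to the relations - $\mathbf a_u\mathbf a_v=\mathbf a_v\mathbf a_u$ for all $u,v\in V$; - $\mathbf a_u\mathbf a_v\mathbf a_w=\mathbf a_{u'}\mathbf a_{v'}\mathbf a_{w'}$ whenever $\{u,v,w\},\{u',v',w'\}\in E$; - $\mathbf a_u\mathbf a_v\mathbf a_w=0$ whenever $\{u,v,w\}\notin E$; - $\mathbf a_u\mathbf a_v=0$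 whenever $u=v$ or $\{u,v\}$ is not a subhyperedge; - $0\,\mathbf a_u=\mathbf a_u\,0=0\cdot 0=0$ for all $u\in V$; - $\mathbf a_u\mathbf a_v=\mathbf a_{u'}\mathbf a_{v'}$ whenever $\{u,v\}$ and $\{u',v'\}$ are linked. Its addition is the flat addition: $x+x=x$, and $x+y=0$ for $x\ne y$. (This semigroup is 0-cancellative, so $S_{\mathbb H}$ is an ai-semiring.) For $i\ge 1$ the *$i$-th beam-type 3-hypergraph* $\mathbb B_i$, a strip of $i$ triangles, has the $3i+3$ vertices $c_0,\dots,c_{i+1}$, $m_0,\dots,m_i$, $r_0,\dots,r_{i-1}$ and the $2i+1$ hyperedges $\{c_j,m_j,c_{j+1}\}$ $(0\le j\le i)$ and $\{c_j,r_j,c_{j+2}\}$ $(0\le j\le i-1)$. In particular $\mathbb B_1$ is the triangle (the 3-cycle of three hyperedges). **Proposition.** For all $i\ge 1$, $\mathbf V(S_{\mathbb B_i})=\mathbf V(S_{\mathbb B_1})$. -/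

import Mathlib

universe u v

/-! ### Additively idempotent semirings and their varieties -/

/-- An additively idempotent semiring: `+` is a commutative idempotent semigroup operation, `*` is
an associative operation, and `*` distributes over `+` on both sides. No neutral elements are
required. -/
class AISemiring (S : Type u) extends AddCommSemigroup S, Semigroup S, Distrib S where
  add_self : ∀ x : S, x + x = x

/-- A homomorphism of ai-semirings preserves the two operations. -/
structure IsAISemiringHom {S : Type u} {T : Type v} [AISemiring S] [AISemiring T]
    (f : S → T) : Prop where
  map_add : ∀ x y, f (x + y) = f x + f y
  map_mul : ∀ x y, f (x * y) = f x * f y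

/-- The direct product of ai-semirings, with coordinatewise operations. -/
instance Pi.instAISemiring {I : Type u} {S : I → Type v} [∀ i, AISemiring (S i)] :
    AISemiring (∀ i, S i) where
  add_assoc x y z := funext fun i => add_assoc (x i) (y i) (z i)
  add_comm x y := funext fun i => add_comm (x i) (y i)
  mul_assoc x y z := funext fun i => mul_assoc (x i) (y i) (z i)
  left_distrib x y z := funext fun i => mul_add (x i) (y i) (z i)
  right_distrib x y z := funext fun i => add_mul (x i) (y i) (z i)
  add_self x := funext fun i => AISemiring.add_self (x i)

/-- The objects of the varieties: (nonempty) ai-semirings. -/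
structure BundledAISemiring where
  carrier : Type u
  [nonempty : Nonempty carrier]
  [str : AISemiring carrier]

namespace BundledAISemiring

attribute [instance] nonempty str

/-- The direct product of a family of ai-semirings. -/
def prod {I : Type u} (S : I → BundledAISemiring.{u}) : BundledAISemiring.{u} where
  carrier := ∀ i, (S i).carrier

/-- A variety of ai-semirings: a class of ai-semirings closed under homomorphic images,
subsemirings (up to isomorphism) and direct products. -/
structure IsVariety (K : Set BundledAISemiring.{u}) : Prop where
  homImage : ∀ S ∈ K, ∀ (T : BundledAISemiring.{u}) (f : S.carrier → T.carrier),
    IsAISemiringHom f → Function.Surjective f → T ∈ K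
  subsemiring : ∀ S ∈ K, ∀ (T : BundledAISemiring.{u}) (f : T.carrier → S.carrier),
    IsAISemiringHom f → Function.Injective f → T ∈ K
  product : ∀ (I : Type u) (S : I → BundledAISemiring.{u}), (∀ i, S i ∈ K) → prod S ∈ K

/-- `V(S)`, the variety generated by `S`: the smallest variety containing `S`. -/
def generatedVariety (S : BundledAISemiring.{u}) : Set BundledAISemiring.{u} :=
  {T | ∀ K : Set BundledAISemiring.{u}, IsVariety K → S ∈ K → T ∈ K}

end BundledAISemiring

/-! ### 3-hypergraphs -/

/-- A finite, linear, 3-uniform hypergraph without isolated vertices and with at least one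
hyperedge, whose vertex set is the whole type `V`. (A 3-uniform hypergraph has no loops.) -/
structure ThreeHypergraph (V : Type u) extends Hypergraph V where
  vertexSet_eq : vertexSet = Set.univ
  finite : Finite V
  edge_nonempty : edgeSet.Nonempty
  uniform : ∀ e ∈ edgeSet, e.ncard = 3
  linear : ∀ e ∈ edgeSet, ∀ f ∈ edgeSet, e ≠ f → (e ∩ f).Subsingleton
  no_isolated : ∀ x, ¬ toHypergraph.IsIsolated x

/-- A subhyperedge is a subset of a hyperedge. -/
def Hypergraph.IsSubhyperedge {V : Type u} (H : Hypergraph V) (s : Set V) : Prop :=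
  ∃ e ∈ H.edgeSet, s ⊆ e

/-- Two subhyperedges are linked if a single vertex completes each of them to a hyperedge. -/
def Hypergraph.Linked {V : Type u} (H : Hypergraph V) (s t : Set V) : Prop :=
  ∃ w, w ∉ s ∧ w ∉ t ∧ insert w s ∈ H.edgeSet ∧ insert w t ∈ H.edgeSet

/-! ### The hypergraph semigroup, by generators and relations -/

/-- The generators: a symbol `0` and a symbol `a_u` for each vertex `u`. -/
inductive HypergraphGen (V : Type u) : Type u
  | zero : HypergraphGen V
  | vert : V → HypergraphGen V

namespace ThreeHypergraph

variable {V : Type u}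

/-- The word `0`. -/
def zeroWord : FreeSemigroup (HypergraphGen V) := FreeSemigroup.of .zero

/-- The word `a_u`. -/
def vertWord (x : V) : FreeSemigroup (HypergraphGen V) := FreeSemigroup.of (.vert x)

/-- The defining relations of the hypergraph semigroup. The relation `edge` says that the words of
all hyperedges represent one and the same element (usually written `a`). -/
inductive Rel (H : ThreeHypergraph V) :
    FreeSemigroup (HypergraphGen V) → FreeSemigroup (HypergraphGen V) → Prop
  | comm (x y : V) : Rel H (vertWord x * vertWord y) (vertWord y * vertWord x)
  | edge (x y z x' y' z' : V) : {x, y, z} ∈ H.edgeSet → {x', y', z'} ∈ H.edgeSet →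
      Rel H (vertWord x * vertWord y * vertWord z) (vertWord x' * vertWord y' * vertWord z')
  | nonedge (x y z : V) : {x, y, z} ∉ H.edgeSet →
      Rel H (vertWord x * vertWord y * vertWord z) zeroWord
  | nonsub (x y : V) : x = y ∨ ¬ H.IsSubhyperedge {x, y} →
      Rel H (vertWord x * vertWord y) zeroWord
  | zero_vert (x : V) : Rel H (zeroWord * vertWord x) zeroWord
  | vert_zero (x : V) : Rel H (vertWord x * zeroWord) zeroWord
  | zero_zero : Rel H (zeroWord * zeroWord) zeroWord
  | linked (x y x' y' : V) : H.Linked {x, y} {x', y'} →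
      Rel H (vertWord x * vertWord y) (vertWord x' * vertWord y')

/-- The carrier of `S_H`: the hypergraph semigroup, i.e. the quotient of the free semigroup on the
generators by the congruence generated by the defining relations. -/
def Carrier (H : ThreeHypergraph V) : Type u := (conGen H.Rel).Quotient

instance (H : ThreeHypergraph V) : Semigroup H.Carrier :=
  inferInstanceAs (Semigroup (conGen H.Rel).Quotient)

/-- The class of a word. -/
def word (H : ThreeHypergraph V) : FreeSemigroup (HypergraphGen V) →ₙ* H.Carrier where
  toFun w := ((w : (conGen H.Rel).Quotient))
  map_mul' _ _ := rfl

instance (H : ThreeHypergraph V) : Zero H.Carrier := ⟨H.word zeroWord⟩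

open Classical in
/-- The flat addition: `x + x = x`, and `x + y = 0` for distinct `x` and `y`. -/
noncomputable instance (H : ThreeHypergraph V) : Add H.Carrier :=
  ⟨fun x y => if x = y then x else 0⟩

/-! The next facts show that the hypergraph semigroup is 0-cancellative, so that with the flat
addition it is an ai-semiring. They compare it with an explicit model. -/

/-- Elements of the model: `0`, the product of a hyperedge, `a_u`, and the products of two vertices
of a hyperedge, indexed by the third vertex. -/
inductive Model (H : ThreeHypergraph V) : Type u
  | zero : Model H
  | top : Model H
  | vert : V → Model H
  | pair : V → Model H

open Classical in
/-- Multiplication of the model. -/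
noncomputable def Model.mul (H : ThreeHypergraph V) : Model H → Model H → Model H
  | .vert x, .vert y => if h : ∃ z, {x, y, z} ∈ H.edgeSet then .pair h.choose else .zero
  | .vert x, .pair y => if x = y then .top else .zero
  | .pair x, .vert y => if x = y then .top else .zero
  | _, _ => .zero

variable (H : ThreeHypergraph V)

theorem edge_distinct {x y z : V} (h : {x, y, z} ∈ H.edgeSet) : x ≠ y ∧ x ≠ z ∧ y ≠ z := by
  have h3 := H.uniform _ h
  have key : ∀ a b : V, ({a, b} : Set V).ncard ≠ 3 := fun a b hab => by
    have := Set.ncard_insert_le a ({b} : Set V)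
    simp only [Set.ncard_singleton] at this
    omega
  refine ⟨?_, ?_, ?_⟩ <;> rintro rfl
  · rw [Set.insert_eq_of_mem (by simp)] at h3; exact key _ _ h3
  · rw [Set.insert_eq_of_mem (by simp)] at h3; exact key _ _ h3
  · rw [Set.insert_eq_of_mem (a := y) (s := {y}) (by simp)] at h3; exact key _ _ h3

theorem edge_eq {x y : V} {e f : Set V} (hxy : x ≠ y) (he : e ∈ H.edgeSet) (hf : f ∈ H.edgeSet)
    (hx : x ∈ e) (hy : y ∈ e) (hx' : x ∈ f) (hy' : y ∈ f) : e = f := by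
  by_contra hne
  exact hxy (H.linear e he f hf hne ⟨hx, hx'⟩ ⟨hy, hy'⟩)

theorem edge_unique {x y z w : V} (h : {x, y, z} ∈ H.edgeSet) (h' : {x, y, w} ∈ H.edgeSet) :
    z = w := by
  have d := H.edge_distinct h
  have e := H.edge_eq d.1 h h' (by simp) (by simp) (by simp) (by simp)
  have hz : z ∈ ({x, y, w} : Set V) := e ▸ (by simp : z ∈ ({x, y, z} : Set V))
  simp only [Set.mem_insert_iff, Set.mem_singleton_iff] at hz
  rcases hz with hz | hz | hz
  · exact absurd hz.symm d.2.1
  · exact absurd hz.symm d.2.2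
  · exact hz

theorem exists_third {x y : V} {e : Set V} (hxy : x ≠ y) (he : e ∈ H.edgeSet) (hx : x ∈ e)
    (hy : y ∈ e) : ∃ z, {x, y, z} ∈ H.edgeSet := by
  have h3 := H.uniform e he
  have hsub : ({x, y} : Set V) ⊆ e := by
    rintro a (rfl | rfl)
    · exact hx
    · exact hy
  have hfin : ({x, y} : Set V).Finite := by simp
  have h1 : (e \ {x, y}).ncard = 1 := by
    have := Set.ncard_sdiff hsub hfin
    rw [h3, Set.ncard_pair hxy] at this
    exact this
  obtain ⟨z, hz⟩ := Set.ncard_eq_one.1 h1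
  refine ⟨z, ?_⟩
  have : ({x, y, z} : Set V) = e := by
    rw [← Set.union_sdiff_cancel hsub, hz]
    ext
    simp only [Set.mem_insert_iff, Set.mem_singleton_iff, Set.mem_union]
    tauto
  rwa [this]

theorem Model.mul_of_edge {x y z : V} (h : {x, y, z} ∈ H.edgeSet) :
    Model.mul H (.vert x) (.vert y) = .pair z := by
  have hex : ∃ z, {x, y, z} ∈ H.edgeSet := ⟨z, h⟩
  simp only [Model.mul, dif_pos hex, Model.pair.injEq]
  exact H.edge_unique hex.choose_spec h

theorem Model.mul_of_not {x y : V} (h : ¬ ∃ z, {x, y, z} ∈ H.edgeSet) :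
    Model.mul H (.vert x) (.vert y) = .zero := by
  simp only [Model.mul, dif_neg h]

theorem edge_swap {x y z : V} : ({y, x, z} : Set V) ∈ H.edgeSet ↔ {x, y, z} ∈ H.edgeSet := by
  rw [Set.insert_comm]

theorem edge_rot {x y z : V} : ({y, z, x} : Set V) ∈ H.edgeSet ↔ {x, y, z} ∈ H.edgeSet := by
  rw [show ({y, z, x} : Set V) = {x, y, z} by ext; simp; tauto]

open Classical in
theorem Model.mul_triple (x y z : V) :
    Model.mul H (Model.mul H (.vert x) (.vert y)) (.vert z) =
      if {x, y, z} ∈ H.edgeSet then .top else .zero := by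
  by_cases h : ∃ w, {x, y, w} ∈ H.edgeSet
  · obtain ⟨w, hw⟩ := h
    rw [Model.mul_of_edge H hw]
    by_cases hwz : w = z
    · subst hwz; simp [Model.mul, hw]
    · rw [if_neg fun h' => hwz (H.edge_unique hw h')]; simp [Model.mul, hwz]
  · rw [Model.mul_of_not H h, if_neg fun h' => h ⟨_, h'⟩]; rfl

open Classical in
theorem Model.mul_triple' (x y z : V) :
    Model.mul H (.vert x) (Model.mul H (.vert y) (.vert z)) =
      if {x, y, z} ∈ H.edgeSet then .top else .zero := by
  by_cases h : ∃ w, {y, z, w} ∈ H.edgeSet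
  · obtain ⟨w, hw⟩ := h
    rw [Model.mul_of_edge H hw]
    by_cases hwz : x = w
    · subst hwz; rw [if_pos (H.edge_rot.1 hw)]; simp [Model.mul]
    · rw [if_neg fun h' => hwz (H.edge_unique (H.edge_rot.2 h') hw)]; simp [Model.mul, hwz]
  · rw [Model.mul_of_not H h, if_neg fun h' => h ⟨_, H.edge_rot.2 h'⟩]; rfl

/-- The multiplication of the model is associative. -/
noncomputable instance : Semigroup (Model H) where
  mul := Model.mul H
  mul_assoc p q r := by
    change Model.mul H (Model.mul H p q) r = Model.mul H p (Model.mul H q r)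
    have hv : ∀ x y, (∃ w, Model.mul H (.vert x) (.vert y) = .pair w) ∨
        Model.mul H (.vert x) (.vert y) = .zero := fun x y => by
      by_cases h : ∃ w, {x, y, w} ∈ H.edgeSet
      · exact .inl ⟨_, Model.mul_of_edge H h.choose_spec⟩
      · exact .inr (Model.mul_of_not H h)
    have hp : ∀ x y, Model.mul H (.vert x) (.pair y) = .top ∨
        Model.mul H (.vert x) (.pair y) = .zero := fun x y => by
      by_cases h : x = y <;> simp [Model.mul, h]
    have hq : ∀ x y, Model.mul H (.pair x) (.vert y) = .top ∨
        Model.mul H (.pair x) (.vert y) = .zero := fun x y => by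
      by_cases h : x = y <;> simp [Model.mul, h]
    rcases p with _ | _ | x | x <;> rcases q with _ | _ | y | y <;> rcases r with _ | _ | z | z
    case vert.vert.vert => rw [Model.mul_triple, Model.mul_triple']
    all_goals
      first
      | rfl
      | (rcases hv x y with ⟨w, h⟩ | h <;> rw [h] <;> rfl)
      | (rcases hv y z with ⟨w, h⟩ | h <;> rw [h] <;> rfl)
      | (rcases hp x y with h | h <;> rw [h] <;> rfl)
      | (rcases hp y z with h | h <;> rw [h] <;> rfl)
      | (rcases hq x y with h | h <;> rw [h] <;> rfl)
      | (rcases hq y z with h | h <;> rw [h] <;> rfl)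
      | (rcases hp x y with h | h <;> rcases hq y z with h' | h' <;> rw [h, h'] <;> rfl)
      | (rcases hq x y with h | h <;> rcases hp y z with h' | h' <;> rw [h, h'] <;> rfl)
      | (rcases hq x y with h | h <;> rcases hv y z with ⟨w, h'⟩ | h' <;> rw [h, h'] <;> rfl)
      | (rcases hv x y with ⟨w, h⟩ | h <;> rcases hp y z with h' | h' <;> rw [h, h'] <;> rfl)

/-- Evaluation of words in the model. -/
noncomputable def Model.eval : FreeSemigroup (HypergraphGen V) →ₙ* Model H :=
  FreeSemigroup.lift fun g => match g with
    | .zero => .zero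
    | .vert x => .vert x

theorem Model.eval_vert (x : V) : Model.eval H (vertWord x) = .vert x := rfl

theorem Model.eval_zero : Model.eval H zeroWord = .zero := rfl

theorem Model.mul_def (p q : Model H) : p * q = Model.mul H p q := rfl

theorem Model.eval_rel {p q : FreeSemigroup (HypergraphGen V)} (h : H.Rel p q) :
    Model.eval H p = Model.eval H q := by
  classical
  cases h with
  | comm x y =>
    simp only [map_mul, Model.eval_vert, Model.mul_def]
    by_cases h : ∃ z, {x, y, z} ∈ H.edgeSet
    · obtain ⟨z, h⟩ := h
      rw [Model.mul_of_edge H h, Model.mul_of_edge H (H.edge_swap.2 h)]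
    · rw [Model.mul_of_not H h, Model.mul_of_not H fun ⟨z, h'⟩ => h ⟨z, H.edge_swap.1 h'⟩]
  | edge x y z x' y' z' h h' =>
    simp only [map_mul, Model.eval_vert, Model.mul_def, Model.mul_triple, if_pos h, if_pos h']
  | nonedge x y z h =>
    simp only [map_mul, Model.eval_vert, Model.mul_def, Model.mul_triple, if_neg h,
      Model.eval_zero]
  | nonsub x y h =>
    simp only [map_mul, Model.eval_vert, Model.mul_def, Model.eval_zero]
    refine Model.mul_of_not H ?_
    rintro ⟨z, hz⟩
    rcases h with h | h
    · exact (H.edge_distinct hz).1 h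
    · exact h ⟨_, hz, by intro a; simp; tauto⟩
  | zero_vert x => rfl
  | vert_zero x => rfl
  | zero_zero => rfl
  | linked x y x' y' h =>
    obtain ⟨w, -, -, h, h'⟩ := h
    simp only [map_mul, Model.eval_vert, Model.mul_def]
    rw [Model.mul_of_edge H (H.edge_rot.2 h), Model.mul_of_edge H (H.edge_rot.2 h')]

theorem Model.eval_con {p q : FreeSemigroup (HypergraphGen V)} (h : conGen H.Rel p q) :
    Model.eval H p = Model.eval H q := by
  change ConGen.Rel H.Rel p q at h
  induction h with
  | of _ _ h => exact Model.eval_rel H h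
  | refl _ => rfl
  | symm _ ih => exact ih.symm
  | trans _ _ ih₁ ih₂ => exact ih₁.trans ih₂
  | mul _ _ ih₁ ih₂ => rw [map_mul, map_mul, ih₁, ih₂]

theorem word_rel {p q : FreeSemigroup (HypergraphGen V)} (h : H.Rel p q) : H.word p = H.word q :=
  (Con.eq _).2 (ConGen.Rel.of _ _ h)

theorem word_surjective : Function.Surjective H.word := fun q => Quotient.inductionOn' q fun p =>
  ⟨p, rfl⟩

theorem zero_def : (0 : H.Carrier) = H.word zeroWord := rfl

theorem gen_mul_zero (g : HypergraphGen V) : H.word (FreeSemigroup.of g) * 0 = 0 := by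
  rw [zero_def, ← map_mul]
  cases g with
  | zero => exact H.word_rel .zero_zero
  | vert x => exact H.word_rel (.vert_zero x)

theorem zero_mul_gen (g : HypergraphGen V) : 0 * H.word (FreeSemigroup.of g) = 0 := by
  rw [zero_def, ← map_mul]
  cases g with
  | zero => exact H.word_rel .zero_zero
  | vert x => exact H.word_rel (.zero_vert x)

protected theorem mul_zero (q : H.Carrier) : q * 0 = 0 := by
  obtain ⟨p, rfl⟩ := H.word_surjective q
  induction p with
  | ih1 g => exact H.gen_mul_zero g
  | ih2 g p _ ih => rw [map_mul, mul_assoc, ih]; exact H.gen_mul_zero g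

protected theorem zero_mul (q : H.Carrier) : 0 * q = 0 := by
  obtain ⟨p, rfl⟩ := H.word_surjective q
  induction p with
  | ih1 g => exact H.zero_mul_gen g
  | ih2 g p _ ih => rw [map_mul, ← mul_assoc, H.zero_mul_gen, ih]

/-- `Model.Reps H m p` says that `p` is a normal form word for `m`. -/
inductive Model.Reps : Model H → FreeSemigroup (HypergraphGen V) → Prop
  | zero : Reps .zero zeroWord
  | top (x y z : V) : {x, y, z} ∈ H.edgeSet → Reps .top (vertWord x * vertWord y * vertWord z)
  | vert (x : V) : Reps (.vert x) (vertWord x)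
  | pair (x y z : V) : {x, y, z} ∈ H.edgeSet → Reps (.pair z) (vertWord x * vertWord y)

theorem Model.Reps.unique {m : Model H} {p q : FreeSemigroup (HypergraphGen V)}
    (hp : Model.Reps H m p) (hq : Model.Reps H m q) : H.word p = H.word q := by
  cases hp with
  | zero => cases hq; rfl
  | top x y z h => cases hq with | top x' y' z' h' => exact H.word_rel (.edge _ _ _ _ _ _ h h')
  | vert x => cases hq; rfl
  | pair x y z h =>
    cases hq with
    | pair x' y' _ h' =>
      have d := H.edge_distinct h
      have d' := H.edge_distinct h'
      refine H.word_rel (.linked _ _ _ _ ⟨z, ?_, ?_, H.edge_rot.1 h, H.edge_rot.1 h'⟩)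
      · simp only [Set.mem_insert_iff, Set.mem_singleton_iff]
        rintro (rfl | rfl) <;> simp_all
      · simp only [Set.mem_insert_iff, Set.mem_singleton_iff]
        rintro (rfl | rfl) <;> simp_all

theorem Model.exists_reps (p : FreeSemigroup (HypergraphGen V)) :
    ∃ q, Model.Reps H (Model.eval H p) q ∧ H.word p = H.word q := by
  classical
  induction p with
  | ih1 g =>
    cases g with
    | zero => exact ⟨_, .zero, rfl⟩
    | vert x => exact ⟨_, .vert x, rfl⟩
  | ih2 g p _ ih =>
    obtain ⟨q, hq, hpq⟩ := ih
    rw [map_mul, map_mul, hpq, ← map_mul H.word]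
    generalize Model.eval H p = m at hq
    cases g with
    | zero =>
      refine ⟨zeroWord, ?_, ?_⟩
      · cases hq <;> exact .zero
      · rw [map_mul]; exact H.zero_mul _
    | vert u =>
      change ∃ q', Model.Reps H (Model.mul H (.vert u) m) q' ∧
        H.word (vertWord u * q) = H.word q'
      cases hq with
      | zero => exact ⟨_, .zero, by rw [map_mul]; exact H.mul_zero _⟩
      | top x y z h =>
        refine ⟨_, .zero, ?_⟩
        have d := H.edge_distinct h
        by_cases hu : {u, x, y} ∈ H.edgeSet
        · have : u = z := (H.edge_unique (H.edge_rot.2 hu) h)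
          subst this
          rw [map_mul, H.word_rel (.edge _ _ _ _ _ _ h hu), ← map_mul, ← mul_assoc, ← mul_assoc,
            mul_assoc, map_mul, H.word_rel (.nonsub u u (.inl rfl))]
          exact H.zero_mul _
        · rw [← mul_assoc, ← mul_assoc, map_mul, H.word_rel (.nonedge _ _ _ hu)]
          exact H.zero_mul _
      | vert x =>
        by_cases h : ∃ w, {u, x, w} ∈ H.edgeSet
        · obtain ⟨w, hw⟩ := h
          rw [Model.mul_of_edge H hw]
          exact ⟨_, .pair _ _ _ hw, rfl⟩
        · rw [Model.mul_of_not H h]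
          refine ⟨_, .zero, H.word_rel (.nonsub _ _ ?_)⟩
          by_contra! hc
          obtain ⟨hne, e, he, hs⟩ := hc
          exact h (H.exists_third hne he (hs (by simp)) (hs (by simp)))
      | pair x y z h =>
        by_cases hu : u = z
        · subst hu
          refine ⟨vertWord u * vertWord x * vertWord y, ?_, by rw [mul_assoc]⟩
          simp only [Model.mul, if_true]
          exact .top _ _ _ (H.edge_rot.1 h)
        · refine ⟨zeroWord, ?_, ?_⟩
          · simp only [Model.mul, if_neg hu]; exact .zero
          · rw [← mul_assoc]
            exact H.word_rel (.nonedge _ _ _ fun h' => hu (H.edge_unique (H.edge_rot.2 h') h))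

/-- Distinct elements of the hypergraph semigroup have distinct values in the model. -/
theorem word_eq_of_eval_eq {p q : FreeSemigroup (HypergraphGen V)}
    (h : Model.eval H p = Model.eval H q) : H.word p = H.word q := by
  obtain ⟨p', hp, hp'⟩ := Model.exists_reps H p
  obtain ⟨q', hq, hq'⟩ := Model.exists_reps H q
  rw [h] at hp
  rw [hp', hq']
  exact hp.unique H hq

theorem eval_eq_of_word_eq {p q : FreeSemigroup (HypergraphGen V)}
    (h : H.word p = H.word q) : Model.eval H p = Model.eval H q :=
  Model.eval_con H ((Con.eq _).1 h)

theorem Model.mul_comm (p q : Model H) : Model.mul H p q = Model.mul H q p := by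
  rcases p with _ | _ | x | x <;> rcases q with _ | _ | y | y <;> try rfl
  · by_cases h : ∃ z, {x, y, z} ∈ H.edgeSet
    · obtain ⟨z, h⟩ := h
      rw [Model.mul_of_edge H h, Model.mul_of_edge H (H.edge_swap.2 h)]
    · rw [Model.mul_of_not H h, Model.mul_of_not H fun ⟨z, h'⟩ => h ⟨z, H.edge_swap.1 h'⟩]
  · by_cases h : x = y
    · simp [Model.mul, h]
    · simp [Model.mul, h, Ne.symm h]
  · by_cases h : x = y
    · simp [Model.mul, h]
    · simp [Model.mul, h, Ne.symm h]

theorem Model.cancel {p q r : Model H} (h : Model.mul H p q = Model.mul H p r)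
    (h0 : Model.mul H p q ≠ .zero) : q = r := by
  have hv : ∀ {x y : V} {m : Model H}, Model.mul H (.vert x) (.vert y) = m → m ≠ .zero →
      ∃ w, m = .pair w ∧ {x, y, w} ∈ H.edgeSet := fun {x y m} hm hm0 => by
    by_cases h : ∃ w, {x, y, w} ∈ H.edgeSet
    · obtain ⟨w, hw⟩ := h
      exact ⟨w, hm ▸ Model.mul_of_edge H hw, hw⟩
    · exact absurd (hm ▸ Model.mul_of_not H h) hm0
  have hp : ∀ {x y : V} {m : Model H}, Model.mul H (.vert x) (.pair y) = m → m ≠ .zero →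
      m = .top ∧ x = y := fun {x y m} hm hm0 => by
    by_cases h : x = y
    · simp only [Model.mul, if_pos h] at hm; exact ⟨hm.symm, h⟩
    · simp only [Model.mul, if_neg h] at hm; exact absurd hm.symm hm0
  have hq : ∀ {x y : V} {m : Model H}, Model.mul H (.pair x) (.vert y) = m → m ≠ .zero →
      m = .top ∧ x = y := fun {x y m} hm hm0 => by
    by_cases h : x = y
    · simp only [Model.mul, if_pos h] at hm; exact ⟨hm.symm, h⟩
    · simp only [Model.mul, if_neg h] at hm; exact absurd hm.symm hm0
  have h0' : Model.mul H p r ≠ .zero := h ▸ h0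
  rcases p with _ | _ | x | x <;> rcases q with _ | _ | y | y <;>
    first | exact absurd rfl h0 | skip
  all_goals
    rcases r with _ | _ | z | z <;> first | exact absurd rfl h0' | skip
  · obtain ⟨w, h₁, e₁⟩ := hv rfl h0
    obtain ⟨w', h₂, e₂⟩ := hv rfl h0'
    rw [h₁, h₂] at h
    cases h
    exact congrArg _ (H.edge_unique (H.edge_rot.1 e₁) (H.edge_rot.1 e₂))
  · obtain ⟨w, h₁, -⟩ := hv rfl h0
    rw [h₁, (hp rfl h0').1] at h
    cases h
  · obtain ⟨w, h₁, -⟩ := hv rfl h0'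
    rw [h₁, (hp rfl h0).1] at h
    cases h
  · rw [← (hp rfl h0).2, ← (hp rfl h0').2]
  · rw [← (hq rfl h0).2, ← (hq rfl h0').2]

protected theorem mul_comm (p q : H.Carrier) : p * q = q * p := by
  obtain ⟨p, rfl⟩ := H.word_surjective p
  obtain ⟨q, rfl⟩ := H.word_surjective q
  rw [← map_mul, ← map_mul]
  apply H.word_eq_of_eval_eq
  rw [map_mul, map_mul]
  exact Model.mul_comm H _ _

/-- The 0-cancellative law. -/
theorem zero_cancel {p q r : H.Carrier} (h : p * q = p * r) (h0 : p * q ≠ 0) : q = r := by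
  obtain ⟨p, rfl⟩ := H.word_surjective p
  obtain ⟨q, rfl⟩ := H.word_surjective q
  obtain ⟨r, rfl⟩ := H.word_surjective r
  rw [← map_mul, ← map_mul] at h
  rw [← map_mul] at h0
  have h' := H.eval_eq_of_word_eq h
  rw [map_mul, map_mul] at h'
  refine H.word_eq_of_eval_eq (Model.cancel H h' fun hz => h0 ?_)
  refine H.word_eq_of_eval_eq (q := zeroWord) ?_
  rw [map_mul]
  exact hz

open Classical in
theorem add_def (p q : H.Carrier) : p + q = if p = q then p else 0 := rfl

protected theorem mul_add (p q r : H.Carrier) : p * (q + r) = p * q + p * r := by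
  by_cases h : q = r
  · simp only [add_def, h, if_true]
  · rw [add_def, add_def, if_neg h, H.mul_zero]
    split_ifs with h'
    · by_contra h0
      exact h (H.zero_cancel h' (Ne.symm h0))
    · rfl

/-- The 3-hypergraph semiring `S_H`: the hypergraph semigroup with the flat addition. -/
noncomputable instance : AISemiring H.Carrier where
  add_assoc p q r := by
    by_cases h₁ : p = q <;> by_cases h₂ : q = r <;> by_cases h₃ : p = 0 <;>
      by_cases h₄ : r = 0 <;> simp_all [add_def]
  add_comm p q := by
    simp only [add_def]
    split_ifs <;> simp_all
  left_distrib := H.mul_add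
  right_distrib p q r := by
    rw [H.mul_comm, H.mul_add, H.mul_comm r p, H.mul_comm r q]
  add_self p := by simp only [add_def, if_true]

/-- `S_H` as an object. -/
noncomputable def semiring (H : ThreeHypergraph V) : BundledAISemiring.{u} where
  carrier := H.Carrier
  nonempty := ⟨0⟩

end ThreeHypergraph

/-! ### Beam-type 3-hypergraphs

`B_n` is a strip of `n` triangles: the corners are `0, …, n + 1`, lying alternately on two parallel
lines; consecutive corners are joined across the strip, corners `j` and `j + 2` are joined along
one of the two lines, and each of these `2 n + 1` segments is a hyperedge consisting of its two end
points and a midpoint of its own. -/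

/-- The vertices of `B_n`: the `n + 2` corners, the midpoint `cross j` of the segment from corner
`j` to corner `j + 1`, and the midpoint `rail j` of the segment from corner `j` to corner `j + 2`.
There are `3 n + 3` of them. -/
inductive BeamVertex (n : ℕ) : Type u
  | corner : Fin (n + 2) → BeamVertex n
  | cross : Fin (n + 1) → BeamVertex n
  | rail : Fin n → BeamVertex n

theorem BeamVertex.finite (n : ℕ) : Finite (BeamVertex.{u} n) :=
  Finite.of_surjective
    (fun s : Fin (n + 2) ⊕ Fin (n + 1) ⊕ Fin n => match s with
      | .inl j => BeamVertex.corner j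
      | .inr (.inl j) => BeamVertex.cross j
      | .inr (.inr j) => BeamVertex.rail j)
    (by
      rintro (j | j | j)
      · exact ⟨.inl j, rfl⟩
      · exact ⟨.inr (.inl j), rfl⟩
      · exact ⟨.inr (.inr j), rfl⟩)

/-- The hyperedge across the strip, from corner `j` to corner `j + 1`. -/
def crossEdge {n : ℕ} (j : Fin (n + 1)) : Set (BeamVertex.{u} n) :=
  {.corner ⟨j, by omega⟩, .cross j, .corner ⟨j + 1, by omega⟩}

/-- The hyperedge along the strip, from corner `j` to corner `j + 2`. -/
def railEdge {n : ℕ} (j : Fin n) : Set (BeamVertex.{u} n) :=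
  {.corner ⟨j, by omega⟩, .rail j, .corner ⟨j + 2, by omega⟩}

/-- The `n`-th beam-type 3-hypergraph `B_n`, for `n ≥ 1`; `B_1` is the triangle (3-cycle). -/
def beam (n : ℕ) : ThreeHypergraph (BeamVertex.{u} n) where
  vertexSet := Set.univ
  edgeSet := Set.range crossEdge ∪ Set.range railEdge
  subset_vertexSet_of_mem_edgeSet' := fun _ _ => Set.subset_univ _
  vertexSet_eq := rfl
  finite := BeamVertex.finite n
  edge_nonempty := ⟨crossEdge 0, .inl ⟨0, rfl⟩⟩
  uniform := by
    rintro e (⟨j, rfl⟩ | ⟨j, rfl⟩)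
    · exact Set.ncard_eq_three.2 ⟨_, _, _, by simp, by simp, by simp, rfl⟩
    · exact Set.ncard_eq_three.2 ⟨_, _, _, by simp, by simp, by simp, rfl⟩
  linear := by
    rintro e (⟨j, rfl⟩ | ⟨j, rfl⟩) f (⟨k, rfl⟩ | ⟨k, rfl⟩) hne x ⟨hx, hx'⟩ y ⟨hy, hy'⟩
    all_goals
      simp only [crossEdge, railEdge, Set.mem_insert_iff, Set.mem_singleton_iff] at hx hx' hy hy'
      try have hjk : j ≠ k := fun h => hne (by rw [h])
      try rw [Ne, Fin.ext_iff] at hjk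
      rcases hx with rfl | rfl | rfl <;> rcases hy with rfl | rfl | rfl <;>
        simp_all [Fin.ext_iff] <;> omega
  no_isolated := by
    rintro (⟨j, hj⟩ | j | j) h
    · by_cases hj' : j = n + 1
      · subst hj'
        exact h (crossEdge ⟨n, by omega⟩) (.inl ⟨_, rfl⟩) (by simp [crossEdge])
      · exact h (crossEdge ⟨j, by omega⟩) (.inl ⟨_, rfl⟩) (by simp [crossEdge])
    · exact h (crossEdge j) (.inl ⟨_, rfl⟩) (by simp [crossEdge])
    · exact h (railEdge j) (.inr ⟨_, rfl⟩) (by simp [railEdge])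

/-! Each inclusion follows from one criterion, `semiring_mem_of_separated`: if every non-hyperedge
triple of `G` is sent to a non-hyperedge by some homomorphism `G → H`, then `S_G` lies in every
variety containing `S_H`. In the power of `S_H` indexed by all homomorphisms, a vertex `x` gives the
tuple of the `a_{f x}`. Products that are nonzero in `S_G` are computed coordinatewise. A zero
product either acquires a zero coordinate or is a tuple `a_u a_v` with `u, v` in no common
hyperedge, which may vanish nowhere but is annihilated, up to zero coordinates, by all tuples in
play. Collapsing these two kinds of tuples to zero leaves `S_G`.

For beams, the triangle embeds in every beam as an induced subhypergraph. Conversely, colour a beam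
by corner index modulo 3, giving each segment's midpoint the colour its ends lack. Any set of
vertices meeting each hyperedge exactly once then yields a homomorphism to the triangle: colours are
kept, and exactly the members of the set go to midpoints. Such sets, one for each corner together
with the set of all midpoints, suffice to recognise the hyperedges (`separated_beam_triangle`). -/

namespace ThreeHypergraph

/-! ### The model as an ai-semiring -/

section ModelSemiring

variable {V : Type u} (H : ThreeHypergraph V)

open Classical in
/-- The flat addition of the model. -/
noncomputable instance : Add (Model H) := ⟨fun p q => if p = q then p else .zero⟩

open Classical in
theorem Model.add_def (p q : Model H) : p + q = if p = q then p else .zero := rfl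

theorem Model.add_self (p : Model H) : p + p = p := by simp [Model.add_def]

theorem Model.add_of_ne {p q : Model H} (h : p ≠ q) : p + q = .zero := by
  simp [Model.add_def, h]

theorem Model.zero_mul (p : Model H) : (.zero : Model H) * p = .zero := by
  cases p <;> rfl

theorem Model.mul_zero (p : Model H) : p * (.zero : Model H) = .zero := by
  cases p <;> rfl

theorem Model.mul_add (p q r : Model H) : p * (q + r) = p * q + p * r := by
  by_cases h : q = r
  · simp only [Model.add_def, h, if_true]
  · rw [Model.add_def, Model.add_def, if_neg h, Model.mul_zero]
    split_ifs with h'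
    · by_contra h0
      exact h (Model.cancel H h' (Ne.symm h0))
    · rfl

/-- The model with the flat addition. -/
noncomputable instance : AISemiring (Model H) where
  add_assoc p q r := by
    by_cases h₁ : p = q <;> by_cases h₂ : q = r <;> by_cases h₃ : p = .zero <;>
      by_cases h₄ : r = .zero <;> simp_all [Model.add_def]
  add_comm p q := by
    simp only [Model.add_def]
    split_ifs <;> simp_all
  mul_assoc p q r := mul_assoc p q r
  left_distrib := Model.mul_add H
  right_distrib p q r := by
    have hc : ∀ a b : Model H, a * b = b * a := Model.mul_comm H
    rw [hc, Model.mul_add, hc r p, hc r q]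
  add_self := Model.add_self H

/-- The model as an object. -/
noncomputable def modelSemiring : BundledAISemiring.{u} where
  carrier := Model H
  nonempty := ⟨.zero⟩

/-- The value in the model of an element of the hypergraph semigroup. -/
noncomputable def toModel (q : H.Carrier) : Model H :=
  Model.eval H (H.word_surjective q).choose

theorem toModel_word (p : FreeSemigroup (HypergraphGen V)) :
    H.toModel (H.word p) = Model.eval H p :=
  H.eval_eq_of_word_eq (H.word_surjective (H.word p)).choose_spec

theorem toModel_injective : Function.Injective H.toModel := by
  intro p q h
  obtain ⟨p, rfl⟩ := H.word_surjective p
  obtain ⟨q, rfl⟩ := H.word_surjective q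
  rw [toModel_word, toModel_word] at h
  exact H.word_eq_of_eval_eq h

/-- The absence of isolated vertices enters here: otherwise the element `pair x` of the model would
be no product of vertices, and `toModel` would not be onto. -/
theorem exists_pair_edge (x : V) : ∃ y z, {y, z, x} ∈ H.edgeSet := by
  have h := H.no_isolated x
  simp only [Hypergraph.IsIsolated, not_forall, not_not] at h
  obtain ⟨e, he, hx⟩ := h
  obtain ⟨a, b, c, -, -, -, rfl⟩ := Set.ncard_eq_three.1 (H.uniform e he)
  rcases hx with rfl | rfl | rfl
  · exact ⟨b, c, H.edge_rot.2 he⟩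
  · exact ⟨c, a, H.edge_rot.2 (H.edge_rot.2 he)⟩
  · exact ⟨a, b, he⟩

theorem toModel_surjective : Function.Surjective H.toModel := by
  have key : ∀ m : Model H, ∃ p, Model.eval H p = m := by
    rintro (_ | _ | x | x)
    · exact ⟨zeroWord, rfl⟩
    · obtain ⟨e, he⟩ := H.edge_nonempty
      obtain ⟨a, b, c, -, -, -, rfl⟩ := Set.ncard_eq_three.1 (H.uniform e he)
      refine ⟨vertWord a * vertWord b * vertWord c, ?_⟩
      simp only [map_mul, Model.eval_vert, Model.mul_def, Model.mul_triple, if_pos he]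
    · exact ⟨vertWord x, rfl⟩
    · obtain ⟨y, z, h⟩ := H.exists_pair_edge x
      refine ⟨vertWord y * vertWord z, ?_⟩
      simp only [map_mul, Model.eval_vert, Model.mul_def, Model.mul_of_edge H h]
  intro m
  obtain ⟨p, hp⟩ := key m
  exact ⟨H.word p, (H.toModel_word p).trans hp⟩

theorem toModel_hom : IsAISemiringHom H.toModel where
  map_add p q := by
    by_cases h : p = q
    · subst h
      rw [Model.add_self, AISemiring.add_self]
    · rw [Model.add_of_ne H (H.toModel_injective.ne h), H.add_def, if_neg h, zero_def, toModel_word]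
      rfl
  map_mul p q := by
    obtain ⟨p, rfl⟩ := H.word_surjective p
    obtain ⟨q, rfl⟩ := H.word_surjective q
    rw [← map_mul, toModel_word, toModel_word, toModel_word, map_mul]

/-- Since `toModel` is bijective, it serves here as a surjection and in `semiring_mem` as an
embedding; a variety contains both `S_H` and its model or neither. -/
theorem modelSemiring_mem {K : Set BundledAISemiring.{u}} (hK : BundledAISemiring.IsVariety K)
    (h : H.semiring ∈ K) : H.modelSemiring ∈ K :=
  hK.homImage _ h H.modelSemiring H.toModel H.toModel_hom H.toModel_surjective

theorem semiring_mem {K : Set BundledAISemiring.{u}} (hK : BundledAISemiring.IsVariety K)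
    (h : H.modelSemiring ∈ K) : H.semiring ∈ K :=
  hK.subsemiring _ h H.semiring H.toModel H.toModel_hom H.toModel_injective

end ModelSemiring

/-! ### Separating families of homomorphisms -/

section Separation

variable {V W : Type u}

/-- The homomorphisms of 3-hypergraphs: maps of vertices that send hyperedges to hyperedges. -/
def Homs (G : ThreeHypergraph V) (H : ThreeHypergraph W) : Type u :=
  {f : V → W // ∀ e ∈ G.edgeSet, f '' e ∈ H.edgeSet}

/-- Every triple of vertices of `G` that is not a hyperedge is sent to a triple that is not a
hyperedge by some homomorphism from `G` to `H`. -/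
def Separated (G : ThreeHypergraph V) (H : ThreeHypergraph W) : Prop :=
  ∀ x y z, {x, y, z} ∉ G.edgeSet → ∃ f : Homs G H, {f.1 x, f.1 y, f.1 z} ∉ H.edgeSet

variable {G : ThreeHypergraph V} {H : ThreeHypergraph W}

theorem Homs.edge (f : Homs G H) {x y z : V} (h : {x, y, z} ∈ G.edgeSet) :
    {f.1 x, f.1 y, f.1 z} ∈ H.edgeSet := by
  simpa only [Set.image_insert_eq, Set.image_singleton] using f.2 _ h

/-- The map of models induced by a homomorphism. -/
def Homs.model (f : Homs G H) : Model G → Model H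
  | .zero => .zero
  | .top => .top
  | .vert x => .vert (f.1 x)
  | .pair x => .pair (f.1 x)

theorem Homs.model_eq_zero {f : Homs G H} {p : Model G} (h : f.model p = .zero) : p = .zero := by
  cases p <;> simp_all [Homs.model]

/-- A degenerate triple `a, a, a` is never a hyperedge, so separating it already supplies a
homomorphism. -/
theorem Separated.nonempty (hs : Separated G H) : Nonempty (Homs G H) := by
  obtain ⟨e, he⟩ := G.edge_nonempty
  obtain ⟨a, -⟩ := Set.nonempty_of_ncard_ne_zero (s := e) (by rw [G.uniform e he]; decide)
  obtain ⟨f, -⟩ := hs a a a fun h => (G.edge_distinct h).1 rfl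
  exact ⟨f⟩

/-- Complete `x` to a hyperedge by `a, b`. By linearity `a, b, y` is not a hyperedge, and a
homomorphism that respects this cannot identify `x` with `y`. -/
theorem Separated.exists_ne (hs : Separated G H) {x y : V} (h : x ≠ y) :
    ∃ f : Homs G H, f.1 x ≠ f.1 y := by
  obtain ⟨a, b, hab⟩ := G.exists_pair_edge x
  obtain ⟨f, hf⟩ := hs a b y fun h' => h (G.edge_unique hab h')
  exact ⟨f, fun h' => hf (h' ▸ f.edge hab)⟩

/-- The simultaneous values of all the induced maps of models. -/
def modelEmb (G : ThreeHypergraph V) (H : ThreeHypergraph W) (p : Model G) :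
    Homs G H → Model H := fun f => f.model p

/-- Any single homomorphism tells elements of different kinds apart; within a kind,
`Separated.exists_ne` does. -/
theorem modelEmb_injective (hs : Separated G H) : Function.Injective (modelEmb G H) := by
  intro p q h
  have h' : ∀ f : Homs G H, f.model p = f.model q := congrFun h
  have f₀ := h' hs.nonempty.some
  rcases p with _ | _ | x | x <;> rcases q with _ | _ | y | y <;>
    first | rfl | (simp only [Homs.model, reduceCtorEq] at f₀; done) | skip
  all_goals
    by_contra hne
    obtain ⟨f, hf⟩ := hs.exists_ne (x := x) (y := y) fun h => hne (by rw [h])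
    have := h' f
    simp only [Homs.model, Model.vert.injEq, Model.pair.injEq] at this
    exact hf this

/-! ### Collapsing a subsemiring of the power onto the model of `G` -/

/-- The elements of the power that are to be collapsed to zero. -/
def Collapsed (G : ThreeHypergraph V) (H : ThreeHypergraph W) (x : Homs G H → Model H) : Prop :=
  (∃ f, x f = .zero) ∨ ∃ u v, (¬ ∃ w, {u, v, w} ∈ G.edgeSet) ∧
    x = modelEmb G H (.vert u) * modelEmb G H (.vert v)

/-- The collapse identifies no nonzero element of the model of `G` with zero: induced maps create no
zero coordinates, and a tuple `a_u a_v` equal to that of `pair w` would make `u, v, w` a hyperedge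
under every homomorphism. -/
theorem eq_zero_of_collapsed (hs : Separated G H) {p : Model G}
    (h : Collapsed G H (modelEmb G H p)) : p = .zero := by
  rcases h with ⟨f, hf⟩ | ⟨u, v, huv, h⟩
  · exact Homs.model_eq_zero hf
  · have h' : ∀ f : Homs G H, f.model p = .vert (f.1 u) * .vert (f.1 v) := congrFun h
    have hv : ∀ x y : W, (∃ w, (.vert x : Model H) * .vert y = .pair w) ∨
        (.vert x : Model H) * .vert y = .zero := fun x y => by
      by_cases h : ∃ z, {x, y, z} ∈ H.edgeSet
      · exact .inl ⟨_, Model.mul_of_edge H h.choose_spec⟩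
      · exact .inr (Model.mul_of_not H h)
    cases p with
    | zero => rfl
    | pair w =>
      obtain ⟨f, hf⟩ := hs u v w fun h => huv ⟨w, h⟩
      -- Multiplying by `a_{f w}` turns `pair (f w)` into the top element, but `a_{f u} a_{f v}`
      -- into zero, because `f` separates the triple.
      have h₁ : Model.mul H (f.model (.pair w)) (.vert (f.1 w)) = .zero := by
        rw [h' f, Model.mul_def, Model.mul_triple]
        exact if_neg hf
      simp [Homs.model, Model.mul] at h₁
    | _ =>
      have f₀ := hs.nonempty.some
      rcases hv (f₀.1 u) (f₀.1 v) with ⟨w, hw⟩ | hw <;>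
        exact nomatch (h' f₀).trans hw

/-- Collapsed tuples absorb multiplication. For `a_u a_v` times `a_w`, the triple is not a
hyperedge, and a homomorphism separating it provides a zero coordinate. -/
theorem collapsed_mul_modelEmb (hs : Separated G H) {x : Homs G H → Model H}
    (hx : Collapsed G H x) (p : Model G) : Collapsed G H (x * modelEmb G H p) := by
  rcases hx with ⟨f, hf⟩ | ⟨u, v, huv, rfl⟩
  · exact .inl ⟨f, by rw [Pi.mul_apply, hf, Model.zero_mul]⟩
  · have f₀ := hs.nonempty.some
    cases p with
    | vert w =>
      obtain ⟨f, hf⟩ := hs u v w fun h => huv ⟨w, h⟩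
      exact .inl ⟨f, (Model.mul_triple H (f.1 u) (f.1 v) (f.1 w)).trans (if_neg hf)⟩
    -- Here `p` is zero or a product of two or three vertices, so the whole product is zero in every
    -- coordinate and any homomorphism will do.
    | _ =>
      refine .inl ⟨f₀, ?_⟩
      change (Model.vert (f₀.1 u) : Model H) * .vert (f₀.1 v) * _ = _
      rw [mul_assoc]
      first
      | exact Model.mul_zero H _
      | (simp only [modelEmb, Homs.model, Model.mul_def, Model.mul]
         split_ifs <;> rfl)

theorem collapsed_mul_collapsed (hs : Separated G H) {x y : Homs G H → Model H}
    (hx : Collapsed G H x) (hy : Collapsed G H y) : Collapsed G H (x * y) := by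
  rcases hy with ⟨f, hf⟩ | ⟨u, v, -, rfl⟩
  · exact .inl ⟨f, by rw [Pi.mul_apply, hf, Model.mul_zero]⟩
  · rw [← mul_assoc]
    exact collapsed_mul_modelEmb hs (collapsed_mul_modelEmb hs hx _) _

/-- Homomorphisms of hypergraphs preserve nonzero products, but they may turn a zero product into a
nonzero one; the second alternative accounts for this defect. -/
theorem modelEmb_mul (hs : Separated G H) (p q : Model G) :
    modelEmb G H (p * q) = modelEmb G H p * modelEmb G H q ∨
      p * q = .zero ∧ Collapsed G H (modelEmb G H p * modelEmb G H q) := by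
  rcases p with _ | _ | x | x <;> rcases q with _ | _ | y | y
  case vert.vert =>
    by_cases h : ∃ z, {x, y, z} ∈ G.edgeSet
    · obtain ⟨z, hz⟩ := h
      left
      funext f
      rw [Model.mul_def, Model.mul_of_edge G hz]
      exact (Model.mul_of_edge H (f.edge hz)).symm
    · exact .inr ⟨Model.mul_of_not G h, .inr ⟨x, y, h, rfl⟩⟩
  case vert.pair =>
    by_cases h : x = y
    · left
      funext f
      simp [h, Model.mul_def, Model.mul, modelEmb, Homs.model]
    · obtain ⟨f, hf⟩ := hs.exists_ne h
      refine .inr ⟨by simp [Model.mul_def, Model.mul, h], .inl ⟨f, ?_⟩⟩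
      simp [Model.mul_def, Model.mul, modelEmb, Homs.model, hf]
  case pair.vert =>
    by_cases h : x = y
    · left
      funext f
      simp [h, Model.mul_def, Model.mul, modelEmb, Homs.model]
    · obtain ⟨f, hf⟩ := hs.exists_ne h
      refine .inr ⟨by simp [Model.mul_def, Model.mul, h], .inl ⟨f, ?_⟩⟩
      simp [Model.mul_def, Model.mul, modelEmb, Homs.model, hf]
  all_goals exact .inl (funext fun f => rfl)

/-- `Represents x p` says that the element `x` of the power lies in the subsemiring of interest,
and that its image in the model of `G` is `p`. -/
def Represents (x : Homs G H → Model H) (p : Model G) : Prop :=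
  x = modelEmb G H p ∨ p = .zero ∧ Collapsed G H x

/-- This makes "the element represented by `x`" well defined, so that choosing it gives a map. -/
theorem Represents.unique (hs : Separated G H) {x : Homs G H → Model H} {p q : Model G}
    (hp : Represents x p) (hq : Represents x q) : p = q := by
  rcases hp with rfl | ⟨rfl, hp⟩ <;> rcases hq with hq | ⟨rfl, hq⟩
  · exact modelEmb_injective hs hq
  · exact eq_zero_of_collapsed hs hq
  · subst hq
    exact (eq_zero_of_collapsed hs hp).symm
  · rfl

theorem Represents.collapsed (hs : Separated G H) {x : Homs G H → Model H}
    (h : Represents x (.zero : Model G)) : Collapsed G H x := by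
  rcases h with rfl | ⟨-, h⟩
  · exact .inl ⟨hs.nonempty.some, rfl⟩
  · exact h

theorem Represents.add {x y : Homs G H → Model H} {p q : Model G} (hs : Separated G H)
    (hp : Represents x p) (hq : Represents y q) : Represents (x + y) (p + q) := by
  by_cases h : x = y
  · subst h
    rw [AISemiring.add_self, hp.unique hs hq, AISemiring.add_self]
    exact hq
  · obtain ⟨f, hf⟩ := Function.ne_iff.1 h
    have hz : Collapsed G H (x + y) := .inl ⟨f, Model.add_of_ne H hf⟩
    refine .inr ⟨?_, hz⟩
    -- Two different tuples can represent the same element only if that element is zero.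
    by_cases hpq : p = q
    · subst hpq
      rw [AISemiring.add_self]
      rcases hp with rfl | ⟨rfl, -⟩
      · rcases hq with rfl | ⟨rfl, -⟩
        · exact absurd rfl h
        · rfl
      · rfl
    · exact Model.add_of_ne G hpq

theorem Represents.mul {x y : Homs G H → Model H} {p q : Model G} (hs : Separated G H)
    (hp : Represents x p) (hq : Represents y q) : Represents (x * y) (p * q) := by
  rcases hp with rfl | ⟨rfl, hp⟩
  · rcases hq with rfl | ⟨rfl, hq⟩
    · rcases modelEmb_mul hs p q with h | h
      · exact .inl h.symm
      · exact .inr h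
    · refine .inr ⟨Model.mul_zero G p, ?_⟩
      have : modelEmb G H p * y = y * modelEmb G H p := funext fun f => Model.mul_comm H _ _
      rw [this]
      exact collapsed_mul_modelEmb hs hq p
  · refine .inr ⟨Model.zero_mul G q, ?_⟩
    rcases hq with rfl | ⟨-, hq⟩
    · exact collapsed_mul_modelEmb hs hp q
    · exact collapsed_mul_collapsed hs hp hq

/-- The subsemiring of the power of the model of `H` that is mapped onto the model of `G`. -/
def Represented (G : ThreeHypergraph V) (H : ThreeHypergraph W) : Type u :=
  {x : Homs G H → Model H // ∃ p : Model G, Represents x p}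

/-- The operations of the power restrict to `Represented G H`. -/
@[reducible] noncomputable def representedSemiring (hs : Separated G H) : AISemiring (Represented G H) where
  add x y := ⟨x.1 + y.1, _, x.2.choose_spec.add hs y.2.choose_spec⟩
  mul x y := ⟨x.1 * y.1, _, x.2.choose_spec.mul hs y.2.choose_spec⟩
  add_assoc x y z := Subtype.ext (add_assoc x.1 y.1 z.1)
  add_comm x y := Subtype.ext (add_comm x.1 y.1)
  mul_assoc x y z := Subtype.ext (mul_assoc x.1 y.1 z.1)
  left_distrib x y z := Subtype.ext (mul_add x.1 y.1 z.1)
  right_distrib x y z := Subtype.ext (add_mul x.1 y.1 z.1)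
  add_self x := Subtype.ext (AISemiring.add_self x.1)

/-- `Represented G H` as an object. -/
noncomputable def representedObject (hs : Separated G H) : BundledAISemiring.{u} where
  carrier := Represented G H
  nonempty := ⟨⟨modelEmb G H .zero, .zero, .inl rfl⟩⟩
  str := representedSemiring hs

/-- If the homomorphisms from `G` to `H` separate hyperedges from other triples, then `S_G` lies in
every variety that contains `S_H`. -/
theorem semiring_mem_of_separated (hs : Separated G H) {K : Set BundledAISemiring.{u}}
    (hK : BundledAISemiring.IsVariety K) (h : H.semiring ∈ K) : G.semiring ∈ K := by
  have hP := hK.product (Homs G H) (fun _ => H.modelSemiring) fun _ => H.modelSemiring_mem hK h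
  have hT : representedObject hs ∈ K := hK.subsemiring _ hP (representedObject hs) Subtype.val
    ⟨fun _ _ => rfl, fun _ _ => rfl⟩ Subtype.val_injective
  -- The collapsing map sends a tuple to the element it represents; uniqueness turns closure of
  -- `Represents` under the operations into the homomorphism laws.
  refine G.semiring_mem hK (hK.homImage _ hT G.modelSemiring (fun x => x.2.choose) ⟨?_, ?_⟩ ?_)
  · intro x y
    exact (x + y).2.choose_spec.unique hs (x.2.choose_spec.add hs y.2.choose_spec)
  · intro x y
    exact (x * y).2.choose_spec.unique hs (x.2.choose_spec.mul hs y.2.choose_spec)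
  · intro p
    let x : Represented G H := ⟨modelEmb G H p, p, .inl rfl⟩
    exact ⟨x, x.2.choose_spec.unique hs (.inl rfl)⟩

end Separation

end ThreeHypergraph

/-! ### Homomorphisms between beams -/

/-- The inclusion of a beam in a longer one. -/
def BeamVertex.castLE {m n : ℕ} (h : m ≤ n) : BeamVertex.{u} m → BeamVertex.{u} n
  | .corner j => .corner (j.castLE (by omega))
  | .cross j => .cross (j.castLE (by omega))
  | .rail j => .rail (j.castLE h)

theorem BeamVertex.castLE_injective {m n : ℕ} (h : m ≤ n) :
    Function.Injective (BeamVertex.castLE.{u} h) := by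
  rintro (x | x | x) (y | y | y) hxy <;>
    simp_all [BeamVertex.castLE, Fin.ext_iff]

theorem image_castLE_crossEdge {m n : ℕ} (h : m ≤ n) (j : Fin (m + 1)) :
    BeamVertex.castLE.{u} h '' crossEdge j = crossEdge (j.castLE (by omega)) := by
  simp only [crossEdge, Set.image_insert_eq, Set.image_singleton]
  rfl

theorem image_castLE_railEdge {m n : ℕ} (h : m ≤ n) (j : Fin m) :
    BeamVertex.castLE.{u} h '' railEdge j = railEdge (j.castLE h) := by
  simp only [railEdge, Set.image_insert_eq, Set.image_singleton]
  rfl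

/-- The inclusion alone separates. A hyperedge of the longer beam is determined by its midpoint, so
if it lies in the image of the shorter beam, its midpoint, and hence the whole hyperedge, comes from
there. -/
theorem separated_beam_of_le {m n : ℕ} (h : m ≤ n) :
    ThreeHypergraph.Separated (beam.{u} m) (beam.{u} n) := by
  intro x y z hxyz
  refine ⟨⟨BeamVertex.castLE h, ?_⟩, fun hmem => hxyz ?_⟩
  · rintro e (⟨j, rfl⟩ | ⟨j, rfl⟩)
    · exact .inl ⟨_, (image_castLE_crossEdge h j).symm⟩
    · exact .inr ⟨_, (image_castLE_railEdge h j).symm⟩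
  · have himg : ({BeamVertex.castLE h x, BeamVertex.castLE h y, BeamVertex.castLE h z} :
        Set (BeamVertex.{u} n)) = BeamVertex.castLE h '' {x, y, z} := by
      simp only [Set.image_insert_eq, Set.image_singleton]
    simp only at hmem
    rw [himg] at hmem
    rcases hmem with ⟨j, hj⟩ | ⟨j, hj⟩
    · have hc : BeamVertex.cross j ∈ BeamVertex.castLE.{u} h '' {x, y, z} := hj ▸ by
        simp [crossEdge]
      obtain ⟨a, -, ha⟩ := hc
      rcases a with k | k | k <;> simp only [BeamVertex.castLE, BeamVertex.cross.injEq,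
        reduceCtorEq] at ha
      subst ha
      rw [← image_castLE_crossEdge h] at hj
      exact .inl ⟨k, (BeamVertex.castLE_injective h).image_injective hj⟩
    · have hc : BeamVertex.rail j ∈ BeamVertex.castLE.{u} h '' {x, y, z} := hj ▸ by
        simp [railEdge]
      obtain ⟨a, -, ha⟩ := hc
      rcases a with k | k | k <;> simp only [BeamVertex.castLE, BeamVertex.rail.injEq,
        reduceCtorEq] at ha
      subst ha
      rw [← image_castLE_railEdge h] at hj
      exact .inr ⟨k, (BeamVertex.castLE_injective h).image_injective hj⟩

/-! ### Folding a beam onto the triangle -/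

/-- The corner of the triangle of a given colour modulo 3. -/
def triangleCorner (a : ℕ) : BeamVertex.{u} 1 := .corner ⟨a % 3, by omega⟩

/-- The midpoint of the side of the triangle opposite to the corner of a given colour modulo 3. -/
def triangleMid (a : ℕ) : BeamVertex.{u} 1 :=
  if a % 3 = 0 then .cross 1 else if a % 3 = 1 then .rail 0 else .cross 0

/-- A midpoint carries the colour of the opposite corner, so each side shows all three colours, and
two corners with the midpoint of the third colour form a side. -/
theorem triangle_edge {a b c : ℕ} (hab : a % 3 ≠ b % 3) (hac : a % 3 ≠ c % 3)
    (hbc : b % 3 ≠ c % 3) :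
    {triangleCorner a, triangleCorner b, triangleMid c} ∈ (beam.{u} 1).edgeSet := by
  have h0 : crossEdge.{u} (0 : Fin 2) ∈ (beam.{u} 1).edgeSet := .inl ⟨0, rfl⟩
  have h1 : crossEdge.{u} (1 : Fin 2) ∈ (beam.{u} 1).edgeSet := .inl ⟨1, rfl⟩
  have h2 : railEdge.{u} (0 : Fin 1) ∈ (beam.{u} 1).edgeSet := .inr ⟨0, rfl⟩
  obtain ⟨ha, hb, hc⟩ | ⟨ha, hb, hc⟩ | ⟨ha, hb, hc⟩ | ⟨ha, hb, hc⟩ | ⟨ha, hb, hc⟩ | ⟨ha, hb, hc⟩ :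
      a % 3 = 0 ∧ b % 3 = 1 ∧ c % 3 = 2 ∨ a % 3 = 1 ∧ b % 3 = 0 ∧ c % 3 = 2 ∨
      a % 3 = 1 ∧ b % 3 = 2 ∧ c % 3 = 0 ∨ a % 3 = 2 ∧ b % 3 = 1 ∧ c % 3 = 0 ∨
      a % 3 = 0 ∧ b % 3 = 2 ∧ c % 3 = 1 ∨ a % 3 = 2 ∧ b % 3 = 0 ∧ c % 3 = 1 := by omega
  all_goals simp only [triangleCorner, triangleMid, ha, hb, hc]
  · convert h0 using 1; ext x; simp [crossEdge]; tauto
  · convert h0 using 1; ext x; simp [crossEdge]; tauto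
  · convert h1 using 1; ext x; simp [crossEdge]; tauto
  · convert h1 using 1; ext x; simp [crossEdge]; tauto
  · convert h2 using 1; ext x; simp [railEdge]; tauto
  · convert h2 using 1; ext x; simp [railEdge]; tauto

/-- The property of being a midpoint. -/
def BeamVertex.IsMid {n : ℕ} : BeamVertex.{u} n → Prop
  | .corner _ => False
  | _ => True

/-- Exactly one of three propositions holds. -/
def ExactlyOne (p q r : Prop) : Prop := p ∧ ¬ q ∧ ¬ r ∨ ¬ p ∧ q ∧ ¬ r ∨ ¬ p ∧ ¬ q ∧ r

/-- The midpoints meet each hyperedge exactly once. Applied to the triangle, this pulls back along a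
homomorphism to a constraint on the original triple. -/
theorem exactlyOne_isMid {n : ℕ} {x y z : BeamVertex.{u} n}
    (h : {x, y, z} ∈ (beam.{u} n).edgeSet) : ExactlyOne x.IsMid y.IsMid z.IsMid := by
  have hd := (beam.{u} n).edge_distinct h
  rcases h with ⟨j, hj⟩ | ⟨j, hj⟩
  all_goals
    first
    | (have hx : x ∈ crossEdge j := hj ▸ by simp
       have hy : y ∈ crossEdge j := hj ▸ by simp
       have hz : z ∈ crossEdge j := hj ▸ by simp)
    | (have hx : x ∈ railEdge j := hj ▸ by simp
       have hy : y ∈ railEdge j := hj ▸ by simp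
       have hz : z ∈ railEdge j := hj ▸ by simp)
    clear hj
    rcases hx with rfl | rfl | rfl <;> rcases hy with rfl | rfl | rfl <;>
      rcases hz with rfl | rfl | rfl <;>
      simp_all [ExactlyOne, BeamVertex.IsMid]

open Classical in
/-- The homomorphism from a beam to the triangle that is given by the 3-colouring of the beam and
by the exact hitting set consisting of the corner `p` and of the midpoints of all segments that do
not end there: the members of the hitting set are sent to midpoints. -/
noncomputable def beamFold {n : ℕ} (p : ℕ) : BeamVertex.{u} n → BeamVertex.{u} 1
  | .corner j => if (j : ℕ) = p then triangleMid j else triangleCorner j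
  | .cross j => if (j : ℕ) = p ∨ (j : ℕ) + 1 = p then triangleCorner (j + 2) else triangleMid (j + 2)
  | .rail j => if (j : ℕ) = p ∨ (j : ℕ) + 2 = p then triangleCorner (j + 1) else triangleMid (j + 1)

theorem beamFold_edge {n : ℕ} (p : ℕ) {e : Set (BeamVertex.{u} n)}
    (he : e ∈ (beam.{u} n).edgeSet) : beamFold p '' e ∈ (beam.{u} 1).edgeSet := by
  have key : ∀ a b c : ℕ, a % 3 ≠ b % 3 → a % 3 ≠ c % 3 → b % 3 ≠ c % 3 →
      {triangleCorner a, triangleMid b, triangleCorner c} ∈ (beam.{u} 1).edgeSet ∧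
      {triangleMid a, triangleCorner b, triangleCorner c} ∈ (beam.{u} 1).edgeSet ∧
      {triangleCorner a, triangleCorner b, triangleMid c} ∈ (beam.{u} 1).edgeSet := by
    intro a b c hab hac hbc
    refine ⟨?_, ?_, triangle_edge hab hac hbc⟩
    · rw [Set.pair_comm]
      exact triangle_edge hac hab hbc.symm
    · rw [← ThreeHypergraph.edge_rot]
      exact triangle_edge hbc hab.symm hac.symm
  rcases he with ⟨j, rfl⟩ | ⟨j, rfl⟩
  · simp only [crossEdge, Set.image_insert_eq, Set.image_singleton, beamFold]
    -- The colours of the end, the midpoint and the other end of the segment, in the order in which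
    -- `crossEdge` lists them. The three facts cover the possible positions of the member of the
    -- hitting set.
    obtain ⟨h1, h2, h3⟩ := key j (j + 2) (j + 1) (by omega) (by omega) (by omega)
    split_ifs <;> first | assumption | omega
  · simp only [railEdge, Set.image_insert_eq, Set.image_singleton, beamFold]
    obtain ⟨h1, h2, h3⟩ := key j (j + 1) (j + 2) (by omega) (by omega) (by omega)
    split_ifs <;> first | assumption | omega

theorem isMid_triangleMid (a : ℕ) : (triangleMid.{u} a).IsMid := by
  unfold triangleMid
  split_ifs <;> trivial

theorem not_isMid_triangleCorner (a : ℕ) : ¬ (triangleCorner.{u} a).IsMid := id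

theorem isMid_beamFold_corner {n : ℕ} (p : ℕ) (j : Fin (n + 2)) :
    (beamFold.{u} p (.corner j)).IsMid ↔ (j : ℕ) = p := by
  simp only [beamFold]
  split_ifs with h <;> simp [h, isMid_triangleMid, not_isMid_triangleCorner]

theorem isMid_beamFold_cross {n : ℕ} (p : ℕ) (j : Fin (n + 1)) :
    (beamFold.{u} p (.cross j)).IsMid ↔ (j : ℕ) ≠ p ∧ (j : ℕ) + 1 ≠ p := by
  simp only [beamFold]
  split_ifs with h <;> simp [isMid_triangleMid, not_isMid_triangleCorner] <;> tauto

theorem isMid_beamFold_rail {n : ℕ} (p : ℕ) (j : Fin n) :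
    (beamFold.{u} p (.rail j)).IsMid ↔ (j : ℕ) ≠ p ∧ (j : ℕ) + 2 ≠ p := by
  simp only [beamFold]
  split_ifs with h <;> simp [isMid_triangleMid, not_isMid_triangleCorner] <;> tauto

/-- The midpoint is missing from the hitting sets of the two ends `l` and `l + 1` of its segment, so
each end must be one of the corners `j`, `k`. -/
theorem edge_of_exactlyOne_cross {n : ℕ} {j k : Fin (n + 2)} {l : Fin (n + 1)}
    (h : ∀ p : ℕ, ExactlyOne ((j : ℕ) = p) ((k : ℕ) = p) ((l : ℕ) ≠ p ∧ (l : ℕ) + 1 ≠ p)) :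
    {.corner j, .corner k, .cross l} ∈ (beam.{u} n).edgeSet := by
  obtain ⟨j, hjn⟩ := j
  obtain ⟨k, hkn⟩ := k
  have h1 := h l
  have h2 := h (l + 1)
  simp only [ExactlyOne] at h1 h2
  have h3 : j = (l : ℕ) ∧ k = (l : ℕ) + 1 ∨ k = (l : ℕ) ∧ j = (l : ℕ) + 1 := by omega
  refine .inl ⟨l, ?_⟩
  rcases h3 with ⟨rfl, rfl⟩ | ⟨rfl, rfl⟩
  · rw [Set.pair_comm, crossEdge]
  · rw [Set.insert_comm, Set.pair_comm, crossEdge]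

theorem edge_of_exactlyOne_rail {n : ℕ} {j k : Fin (n + 2)} {l : Fin n}
    (h : ∀ p : ℕ, ExactlyOne ((j : ℕ) = p) ((k : ℕ) = p) ((l : ℕ) ≠ p ∧ (l : ℕ) + 2 ≠ p)) :
    {.corner j, .corner k, .rail l} ∈ (beam.{u} n).edgeSet := by
  obtain ⟨j, hjn⟩ := j
  obtain ⟨k, hkn⟩ := k
  have h1 := h l
  have h2 := h (l + 2)
  simp only [ExactlyOne] at h1 h2
  have h3 : j = (l : ℕ) ∧ k = (l : ℕ) + 2 ∨ k = (l : ℕ) ∧ j = (l : ℕ) + 2 := by omega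
  refine .inr ⟨l, ?_⟩
  rcases h3 with ⟨rfl, rfl⟩ | ⟨rfl, rfl⟩
  · rw [Set.pair_comm, railEdge]
  · rw [Set.insert_comm, Set.pair_comm, railEdge]

theorem separated_beam_triangle (n : ℕ) :
    ThreeHypergraph.Separated (beam.{u} n) (beam.{u} 1) := by
  intro x y z
  contrapose!
  intro h
  have hone : ∀ p : ℕ, ExactlyOne (beamFold.{u} p x).IsMid (beamFold.{u} p y).IsMid
      (beamFold.{u} p z).IsMid := fun p =>
    exactlyOne_isMid (h ⟨beamFold p, fun e he => beamFold_edge p he⟩)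
  clear h
  have hrot : ∀ {p q r : Prop}, ExactlyOne p q r → ExactlyOne q r p := by
    unfold ExactlyOne; tauto
  -- A value beyond every corner index makes the hitting set the set of all midpoints; hence exactly
  -- one of `x`, `y`, `z` is a midpoint, and all other distributions of kinds are excluded.
  have hfar := hone (n + 5)
  rcases x with j | j | j <;> rcases y with k | k | k <;> rcases z with l | l | l <;>
    simp only [isMid_beamFold_corner, isMid_beamFold_cross, isMid_beamFold_rail] at hone hfar
  case corner.corner.cross => exact edge_of_exactlyOne_cross hone
  case corner.corner.rail => exact edge_of_exactlyOne_rail hone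
  case corner.cross.corner =>
    rw [← ThreeHypergraph.edge_rot, ← ThreeHypergraph.edge_rot]
    exact edge_of_exactlyOne_cross fun p => hrot (hrot (hone p))
  case corner.rail.corner =>
    rw [← ThreeHypergraph.edge_rot, ← ThreeHypergraph.edge_rot]
    exact edge_of_exactlyOne_rail fun p => hrot (hrot (hone p))
  case cross.corner.corner =>
    rw [← ThreeHypergraph.edge_rot]
    exact edge_of_exactlyOne_cross fun p => hrot (hone p)
  case rail.corner.corner =>
    rw [← ThreeHypergraph.edge_rot]
    exact edge_of_exactlyOne_rail fun p => hrot (hone p)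
  all_goals
    exfalso
    unfold ExactlyOne at hfar
    omega

theorem proposition4p3 (i : ℕ) (hi : 1 ≤ i) :
    BundledAISemiring.generatedVariety.{u} (beam.{u} i).semiring =
      BundledAISemiring.generatedVariety.{u} (beam.{u} 1).semiring := by
  ext T
  exact ⟨fun h K hK hS => h K hK
      (ThreeHypergraph.semiring_mem_of_separated (separated_beam_triangle i) hK hS),
    fun h K hK hS => h K hK
      (ThreeHypergraph.semiring_mem_of_separated (separated_beam_of_le hi) hK hS)⟩
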